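/- Fix a finite signature and a set of variables $\mathcal V$, and consider first-order terms over them. An *order pair* is a pair $(\geqslant,>)$ of relations such that $\geqslant$ is a preorder, $>$ is a strict order (irreflexive and transitive), and $a\geqslant b>c\geqslant d$ implies $a>d$. A relation $>$ is *well-founded* if there is no infinite sequence $a_0>a_1>a_2>\cdots$. A *rewrite preorder* is a preorder on terms closed under substitutions and contexts. A *reduction triple* $(\geqslant,\sqsupseteq,\sqsupset)$ consists of relations on terms such that $\geqslant$ is a rewrite preorder, $(\sqsupseteq,\sqsupset)$ is an order pair with both $\sqsupseteq$ and $\sqsupset$ closed under substitutions and $\sqsupset$ well-founded, and $t_i\geqslant u$ implies $f(t_1,\dots,t_i,\dots,t_n)\sqsupseteq f(t_1,\dots,u,\dots,t_n)$ for all $n$-ary function symbols $f$, terms $t_1,\dots,t_n,u$ and $1\le i\le n$. A *reduction pair* is an order pair $(\geqslant,>)$ on terms such that $\geqslant$ is a rewrite preorder and $>$ is well-founded and closed under substitutions. A *partial status* $\pi$ maps every $n$-ary function symbol $f$ to a list $\pi(f)=[i_1,\dots,i_m]$ with $1\le i_1<\dots<i_m\le n$; write $\pi(f)(t_1,\dots,t_n)=[t_{i_1},\dots,t_{i_m}]$.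 The *lexicographic extension* $(\geqslant^{\mathsf{lex}},>^{\mathsf{lex}})$ of a pair $(\geqslant,>)$ is defined on lists by: $[a_1,\dots,a_m]\geqslant^{\mathsf{lex}}[b_1,\dots,b_n]$ (respectively $>^{\mathsf{lex}}$) if there is $0\le k\le\min(m,n)$ with $a_j\geqslant b_j$ for all $1\le j\le k$ and either $k<\min(m,n)$ and $a_{k+1}>b_{k+1}$, or $k=n$ (respectively $k=n<m$). Given $\pi$ and $(\sqsupseteq,\sqsupset)$, the *semantic path order* $(\geqslant_{\mathsf S},>_{\mathsf S})$ is the pair of relations on terms defined simultaneously by induction as follows: $s\geqslant_{\mathsf S}t$ if one of the following holds. 1. $s=f(s_1,\dots,s_m)$ and $s_i\geqslant_{\mathsf S}t$ for some $i\in\pi(f)$. 2. $s=f(s_1,\dots,s_m)$, $t=g(t_1,\dots,t_n)$, $s>_{\mathsf S}t_j$ for all $j\in\pi(g)$, and (a) $s\sqsupset t$, or (b) $s\sqsupseteq t$ and $\pi(f)(s_1,\dots,s_m)\geqslant_{\mathsf S}^{\mathsf{lex}}\pi(g)(t_1,\dots,t_n)$. 3. $s\in\mathcal V$ and $s=t$.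 The relation $>_{\mathsf S}$ is defined by cases 1, 2a and 2b, with $\geqslant_{\mathsf S}^{\mathsf{lex}}$ replaced by $>_{\mathsf S}^{\mathsf{lex}}$ in 2b. The *monotonic semantic path order* is $\geqslant_{\mathsf{MS}}\;=\;\geqslant\cap\geqslant_{\mathsf S}$. **Corollary.** For every partial status $\pi$ and every reduction triple $(\geqslant,\sqsupseteq,\sqsupset)$, the pair $(\geqslant_{\mathsf{MS}},>_{\mathsf S})$, with $(\geqslant_{\mathsf S},>_{\mathsf S})$ induced by $\pi$ and $(\sqsupseteq,\sqsupset)$, is a reduction pair. -/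

import Mathlib

namespace TermOrder

universe u v w

/- The lexicographic extension of a pair of relations `(ge, gt)` to lists, possibly of different
lengths: components are compared by `ge` from left to right, until one is compared by `gt` or the
right-hand list is exhausted. In the strict version, the left-hand list must then be longer. -/

/-- The weak part of the lexicographic extension of `(ge, gt)`. -/
inductive LexGe {α : Type*} (ge gt : α → α → Prop) : List α → List α → Prop
  | nil (as : List α) : LexGe ge gt as []
  | head (a b : α) (as bs : List α) : gt a b → LexGe ge gt (a :: as) (b :: bs)
  | tail (a b : α) (as bs : List α) :
      ge a b → LexGe ge gt as bs → LexGe ge gt (a :: as) (b :: bs)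

/-- The strict part of the lexicographic extension of `(ge, gt)`. -/
inductive LexGt {α : Type*} (ge gt : α → α → Prop) : List α → List α → Prop
  | nil (a : α) (as : List α) : LexGt ge gt (a :: as) []
  | head (a b : α) (as bs : List α) : gt a b → LexGt ge gt (a :: as) (b :: bs)
  | tail (a b : α) (as bs : List α) :
      ge a b → LexGt ge gt as bs → LexGt ge gt (a :: as) (b :: bs)

/-- An order pair: a preorder and a strict order that are compatible, `ge · gt · ge ⊆ gt`.
The inclusion `gt ⊆ ge` is not required. -/
structure IsOrderPair {α : Type*} (ge gt : α → α → Prop) : Prop where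
  ge_refl : ∀ a, ge a a
  ge_trans : ∀ a b c, ge a b → ge b c → ge a c
  gt_irrefl : ∀ a, ¬ gt a a
  gt_trans : ∀ a b c, gt a b → gt b c → gt a c
  compat : ∀ a b c d, ge a b → gt b c → ge c d → gt a d

/-- There is no infinite descending sequence `a₀ gt a₁ gt a₂ gt ⋯`. -/
def IsWellFoundedGt {α : Type*} (gt : α → α → Prop) : Prop :=
  WellFounded (fun a b => gt b a)

/- Terms over a signature: the function symbols are those of a first-order language `L`
(its relation symbols play no role), the variables are the elements of `V`. -/

variable {L : FirstOrder.Language.{u, v}} {V : Type w}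

/-- Closure under substitutions. -/
def IsStable (R : L.Term V → L.Term V → Prop) : Prop :=
  ∀ (s t : L.Term V) (σ : V → L.Term V), R s t → R (s.subst σ) (t.subst σ)

/-- Closure under contexts: replacing the `i`-th argument of `f(t₁, …, tₙ)` by related terms
gives related terms (by iteration, the same then holds for arbitrary one-hole contexts). -/
def IsClosedUnderContexts (R : L.Term V → L.Term V → Prop) : Prop :=
  ∀ (n : ℕ) (f : L.Functions n) (ts : Fin n → L.Term V) (i : Fin n) (s t : L.Term V),
    R s t → R (.func f (Function.update ts i s)) (.func f (Function.update ts i t))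

/-- A rewrite preorder: a preorder on terms closed under substitutions and contexts. -/
structure IsRewritePreorder (ge : L.Term V → L.Term V → Prop) : Prop where
  refl : ∀ t, ge t t
  trans : ∀ s t u, ge s t → ge t u → ge s u
  stable : IsStable ge
  contexts : IsClosedUnderContexts ge

/-- `sqge` is harmonious to `ge`: `tᵢ ge u` implies
`f(t₁, …, tᵢ, …, tₙ) sqge f(t₁, …, u, …, tₙ)`. -/
def IsHarmonious (sqge ge : L.Term V → L.Term V → Prop) : Prop :=
  ∀ (n : ℕ) (f : L.Functions n) (ts : Fin n → L.Term V) (i : Fin n) (u : L.Term V),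
    ge (ts i) u → sqge (.func f ts) (.func f (Function.update ts i u))

/-- A reduction triple `(ge, sqge, sqgt)`. -/
structure IsReductionTriple (ge sqge sqgt : L.Term V → L.Term V → Prop) : Prop where
  rewritePreorder : IsRewritePreorder ge
  orderPair : IsOrderPair sqge sqgt
  sqge_stable : IsStable sqge
  sqgt_stable : IsStable sqgt
  wellFounded : IsWellFoundedGt sqgt
  harmonious : IsHarmonious sqge ge

/-- A reduction pair `(ge, gt)`. -/
structure IsReductionPair (ge gt : L.Term V → L.Term V → Prop) : Prop where
  orderPair : IsOrderPair ge gt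
  rewritePreorder : IsRewritePreorder ge
  wellFounded : IsWellFoundedGt gt
  gt_stable : IsStable gt

/-- A partial status assigns to every `n`-ary function symbol a strictly increasing list
of argument positions. -/
structure PartialStatus (L : FirstOrder.Language.{u, v}) where
  pos : ∀ {n : ℕ}, L.Functions n → List (Fin n)
  increasing : ∀ {n : ℕ} (f : L.Functions n), (pos f).Pairwise (· < ·)

/-- `π(f)(t₁, …, tₙ)`: the list of the arguments at the positions listed in `π(f)`. -/
def PartialStatus.args (π : PartialStatus L) {n : ℕ} (f : L.Functions n)
    (ts : Fin n → L.Term V) : List (L.Term V) :=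
  (π.pos f).map ts

mutual

/-- The weak semantic path order induced by the partial status `π` and `(sqge, sqgt)`. -/
inductive SPOGe (π : PartialStatus L) (sqge sqgt : L.Term V → L.Term V → Prop) :
    L.Term V → L.Term V → Prop
  | arg {m : ℕ} (f : L.Functions m) (ss : Fin m → L.Term V) (t : L.Term V) (i : Fin m) :
      i ∈ π.pos f → SPOGe π sqge sqgt (ss i) t → SPOGe π sqge sqgt (.func f ss) t
  | strict {m n : ℕ} (f : L.Functions m) (ss : Fin m → L.Term V)
      (g : L.Functions n) (ts : Fin n → L.Term V) :
      (∀ j ∈ π.pos g, SPOGt π sqge sqgt (.func f ss) (ts j)) →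
      sqgt (.func f ss) (.func g ts) →
      SPOGe π sqge sqgt (.func f ss) (.func g ts)
  | lex {m n : ℕ} (f : L.Functions m) (ss : Fin m → L.Term V)
      (g : L.Functions n) (ts : Fin n → L.Term V) :
      (∀ j ∈ π.pos g, SPOGt π sqge sqgt (.func f ss) (ts j)) →
      sqge (.func f ss) (.func g ts) →
      LexGe (SPOGe π sqge sqgt) (SPOGt π sqge sqgt) (π.args f ss) (π.args g ts) →
      SPOGe π sqge sqgt (.func f ss) (.func g ts)
  | var (x : V) : SPOGe π sqge sqgt (.var x) (.var x)

/-- The strict semantic path order induced by the partial status `π` and `(sqge, sqgt)`. -/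
inductive SPOGt (π : PartialStatus L) (sqge sqgt : L.Term V → L.Term V → Prop) :
    L.Term V → L.Term V → Prop
  | arg {m : ℕ} (f : L.Functions m) (ss : Fin m → L.Term V) (t : L.Term V) (i : Fin m) :
      i ∈ π.pos f → SPOGe π sqge sqgt (ss i) t → SPOGt π sqge sqgt (.func f ss) t
  | strict {m n : ℕ} (f : L.Functions m) (ss : Fin m → L.Term V)
      (g : L.Functions n) (ts : Fin n → L.Term V) :
      (∀ j ∈ π.pos g, SPOGt π sqge sqgt (.func f ss) (ts j)) →
      sqgt (.func f ss) (.func g ts) →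
      SPOGt π sqge sqgt (.func f ss) (.func g ts)
  | lex {m n : ℕ} (f : L.Functions m) (ss : Fin m → L.Term V)
      (g : L.Functions n) (ts : Fin n → L.Term V) :
      (∀ j ∈ π.pos g, SPOGt π sqge sqgt (.func f ss) (ts j)) →
      sqge (.func f ss) (.func g ts) →
      LexGt (SPOGe π sqge sqgt) (SPOGt π sqge sqgt) (π.args f ss) (π.args g ts) →
      SPOGt π sqge sqgt (.func f ss) (.func g ts)

end

/-- The monotonic semantic path order: the intersection of `ge` with the weak semantic
path order induced by `π` and `(sqge, sqgt)`. -/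
def MSPOGe (π : PartialStatus L) (ge sqge sqgt : L.Term V → L.Term V → Prop)
    (s t : L.Term V) : Prop :=
  ge s t ∧ SPOGe π sqge sqgt s t

end TermOrder

-- Transitivity and mutual compatibility of the two path relations hold together: each clause
-- recurses into arguments or compares roots by `sqge` and `sqgt`, so nested structural induction
-- works once these laws pass to lists (`TransAt.lex`, `SPO.transAt`).
--
-- Well-foundedness (`SPOGt.isWellFoundedGt`) rests on this: a term is accessible once its arguments
-- selected by the status are. The induction runs on the term under `sqgt` modulo `sqge`, then on
-- the list of accessible arguments under `LexGt`. Irreflexivity follows.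
--
-- The weak path order alone need not be closed under contexts, since rewriting an argument may
-- break `sqge` at the root. Intersecting with `ge` repairs this through harmony.

namespace TermOrder

universe u v w

-- Lexicographic extensions

section Lex

variable {α β : Type*} {ge gt : α → α → Prop} {ge' gt' : β → β → Prop}

theorem LexGt.lexGe {as bs : List α} (h : LexGt ge gt as bs) : LexGe ge gt as bs := by
  induction h with
  | nil a as => exact .nil _
  | head a b as bs h => exact .head _ _ _ _ h
  | tail a b as bs h _ ih => exact .tail _ _ _ _ h ih

theorem LexGe.map_of_forall_mem (φ : α → β) {as bs : List α} (h : LexGe ge gt as bs)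
    (hge : ∀ a ∈ as, ∀ b ∈ bs, ge a b → ge' (φ a) (φ b))
    (hgt : ∀ a ∈ as, ∀ b ∈ bs, gt a b → gt' (φ a) (φ b)) :
    LexGe ge' gt' (as.map φ) (bs.map φ) := by
  induction h with
  | nil as => exact .nil _
  | head a b as bs h => exact .head _ _ _ _ (hgt a (by simp) b (by simp) h)
  | tail a b as bs h _ ih =>
    exact .tail _ _ _ _ (hge a (by simp) b (by simp) h)
      (ih (fun a ha b hb => hge a (by simp [ha]) b (by simp [hb]))
        (fun a ha b hb => hgt a (by simp [ha]) b (by simp [hb])))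

theorem LexGt.map_of_forall_mem (φ : α → β) {as bs : List α} (h : LexGt ge gt as bs)
    (hge : ∀ a ∈ as, ∀ b ∈ bs, ge a b → ge' (φ a) (φ b))
    (hgt : ∀ a ∈ as, ∀ b ∈ bs, gt a b → gt' (φ a) (φ b)) :
    LexGt ge' gt' (as.map φ) (bs.map φ) := by
  induction h with
  | nil a as => exact .nil _ _
  | head a b as bs h => exact .head _ _ _ _ (hgt a (by simp) b (by simp) h)
  | tail a b as bs h _ ih =>
    exact .tail _ _ _ _ (hge a (by simp) b (by simp) h)
      (ih (fun a ha b hb => hge a (by simp [ha]) b (by simp [hb]))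
        (fun a ha b hb => hgt a (by simp [ha]) b (by simp [hb])))

theorem LexGt.of_map (φ : β → α) {as bs : List β} (h : LexGt ge gt (as.map φ) (bs.map φ)) :
    LexGt (fun a b => ge (φ a) (φ b)) (fun a b => gt (φ a) (φ b)) as bs := by
  induction as generalizing bs with
  | nil => cases h
  | cons a as ih =>
    cases bs with
    | nil => exact .nil _ _
    | cons b bs =>
      cases h with
      | head _ _ _ _ h => exact .head _ _ _ _ h
      | tail _ _ _ _ h h' => exact .tail _ _ _ _ h (ih h')

theorem LexGe.map_map {ι : Type*} (φ ψ : ι → α) (l : List ι) (h : ∀ i ∈ l, ge (φ i) (ψ i)) :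
    LexGe ge gt (l.map φ) (l.map ψ) := by
  induction l with
  | nil => exact .nil _
  | cons i l ih =>
    exact .tail _ _ _ _ (h i (by simp)) (ih fun j hj => h j (by simp [hj]))

/-- Transitivity of `ge` and its compatibility with `gt` on either side, at given elements. -/
structure TransAt (ge gt : α → α → Prop) (a b c : α) : Prop where
  ge_ge : ge a b → ge b c → ge a c
  ge_gt : ge a b → gt b c → gt a c
  gt_ge : gt a b → ge b c → gt a c
  gt_gt : gt a b → gt b c → gt a c

/-- The earlier strict position decides. The laws are assumed only for members of the lists because
`SPO.transAt` has them only for arguments, by induction. -/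
theorem TransAt.lex {as bs cs : List α}
    (h : ∀ a ∈ as, ∀ b ∈ bs, ∀ c ∈ cs, TransAt ge gt a b c) :
    TransAt (LexGe ge gt) (LexGt ge gt) as bs cs := by
  induction as generalizing bs cs with
  | nil =>
    constructor <;> intro h₁ h₂ <;> cases h₁ <;> cases h₂
    exact .nil _
  | cons a as ih =>
    cases bs with
    | nil =>
      constructor <;> intro h₁ h₂ <;> cases h₂
      · exact .nil _
      · exact .nil _ _
    | cons b bs =>
      cases cs with
      | nil =>
        constructor <;> intro h₁ h₂
        · exact .nil _
        all_goals exact .nil _ _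
      | cons c cs =>
        have h₀ := h a (by simp) b (by simp) c (by simp)
        have ih := @ih bs cs fun a ha b hb c hc =>
          h a (by simp [ha]) b (by simp [hb]) c (by simp [hc])
        constructor
        · rintro (_ | ⟨_, _, _, _, h₁⟩ | ⟨_, _, _, _, h₁, h₁'⟩)
            (_ | ⟨_, _, _, _, h₂⟩ | ⟨_, _, _, _, h₂, h₂'⟩)
          · exact .head _ _ _ _ (h₀.gt_gt h₁ h₂)
          · exact .head _ _ _ _ (h₀.gt_ge h₁ h₂)
          · exact .head _ _ _ _ (h₀.ge_gt h₁ h₂)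
          · exact .tail _ _ _ _ (h₀.ge_ge h₁ h₂) (ih.ge_ge h₁' h₂')
        · rintro (_ | ⟨_, _, _, _, h₁⟩ | ⟨_, _, _, _, h₁, h₁'⟩)
            (_ | ⟨_, _, _, _, h₂⟩ | ⟨_, _, _, _, h₂, h₂'⟩)
          · exact .head _ _ _ _ (h₀.gt_gt h₁ h₂)
          · exact .head _ _ _ _ (h₀.gt_ge h₁ h₂)
          · exact .head _ _ _ _ (h₀.ge_gt h₁ h₂)
          · exact .tail _ _ _ _ (h₀.ge_ge h₁ h₂) (ih.ge_gt h₁' h₂')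
        · rintro (_ | ⟨_, _, _, _, h₁⟩ | ⟨_, _, _, _, h₁, h₁'⟩)
            (_ | ⟨_, _, _, _, h₂⟩ | ⟨_, _, _, _, h₂, h₂'⟩)
          · exact .head _ _ _ _ (h₀.gt_gt h₁ h₂)
          · exact .head _ _ _ _ (h₀.gt_ge h₁ h₂)
          · exact .head _ _ _ _ (h₀.ge_gt h₁ h₂)
          · exact .tail _ _ _ _ (h₀.ge_ge h₁ h₂) (ih.gt_ge h₁' h₂')
        · rintro (_ | ⟨_, _, _, _, h₁⟩ | ⟨_, _, _, _, h₁, h₁'⟩)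
            (_ | ⟨_, _, _, _, h₂⟩ | ⟨_, _, _, _, h₂, h₂'⟩)
          · exact .head _ _ _ _ (h₀.gt_gt h₁ h₂)
          · exact .head _ _ _ _ (h₀.gt_ge h₁ h₂)
          · exact .head _ _ _ _ (h₀.ge_gt h₁ h₂)
          · exact .tail _ _ _ _ (h₀.ge_ge h₁ h₂) (ih.gt_gt h₁' h₂')

/-- The lexicographic combination of a well-founded `gt`, taken modulo a compatible preorder `ge`,
with a well-founded relation is well-founded. -/
theorem IsWellFoundedGt.lex_prod {r : β → β → Prop} (hrefl : ∀ a, ge a a)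
    (htrans : ∀ a b c, ge a b → ge b c → ge a c) (hcompat : ∀ a b c, ge a b → gt b c → gt a c)
    (hgt : IsWellFoundedGt gt) (hr : IsWellFoundedGt r) :
    IsWellFoundedGt fun p q : α × β => gt p.1 q.1 ∨ ge p.1 q.1 ∧ r p.2 q.2 := by
  -- A step in the second component may move the first along `ge`, so the induction on `a` must
  -- cover every `x` with `ge a x`.
  have key : ∀ a : α, ∀ y : β, ∀ x : α, ge a x →
      Acc (fun q p : α × β => gt p.1 q.1 ∨ ge p.1 q.1 ∧ r p.2 q.2) (x, y) := by
    intro a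
    induction a using hgt.induction with
    | _ a iha =>
      intro y
      induction y using hr.induction with
      | _ y ihy =>
        intro x hax
        refine ⟨_, ?_⟩
        rintro ⟨x', y'⟩ (h | ⟨h, h'⟩)
        · exact iha x' (hcompat _ _ _ hax h) y' x' (hrefl x')
        · exact ihy y' h' x' (htrans _ _ _ hax h)
  exact ⟨fun p => key p.1 p.2 p.1 (hrefl _)⟩

/-- The strict lexicographic extension is well-founded on lists of bounded length. -/
theorem IsWellFoundedGt.lexGt (hrefl : ∀ a, ge a a)
    (htrans : ∀ a b c, ge a b → ge b c → ge a c) (hcompat : ∀ a b c, ge a b → gt b c → gt a c)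
    (hgt : IsWellFoundedGt gt) (N : ℕ) :
    IsWellFoundedGt fun l l' : {l : List α // l.length ≤ N} => LexGt ge gt l.1 l'.1 := by
  have hnil : ∀ n (h : ([] : List α).length ≤ n),
      Acc (fun l' l : {l : List α // l.length ≤ n} => LexGt ge gt l.1 l'.1) ⟨[], h⟩ :=
    fun n h => ⟨_, fun y hy => by cases hy⟩
  induction N with
  | zero =>
    refine ⟨?_⟩
    rintro ⟨_ | ⟨a, as⟩, h⟩
    · exact hnil _ h
    · simp at h
  | succ N ih =>
    -- A nonempty list is a head paired with a shorter tail; the empty list is minimal.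
    have hprod := IsWellFoundedGt.lex_prod hrefl htrans hcompat hgt ih
    have key : ∀ p : α × {l : List α // l.length ≤ N}, ∀ h : (p.1 :: p.2.1).length ≤ N + 1,
        Acc (fun l' l : {l : List α // l.length ≤ N + 1} => LexGt ge gt l.1 l'.1)
          ⟨p.1 :: p.2.1, h⟩ := by
      intro p
      induction p using hprod.induction with
      | _ p ihp =>
        intro h
        refine ⟨_, ?_⟩
        rintro ⟨_ | ⟨b, bs⟩, hb⟩ hlt
        · exact hnil _ hb
        · refine ihp (b, ⟨bs, by simpa using hb⟩) ?_ hb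
          rcases hlt with _ | ⟨_, _, _, _, h₁⟩ | ⟨_, _, _, _, h₁, h₂⟩
          · exact .inl h₁
          · exact .inr ⟨h₁, h₂⟩
    refine ⟨?_⟩
    rintro ⟨_ | ⟨a, as⟩, h⟩
    · exact hnil _ h
    · exact key (a, ⟨as, by simpa using h⟩) h

end Lex

-- Order laws of the semantic path order

variable {L : FirstOrder.Language.{u, v}} {V : Type w} {π : PartialStatus L}
  {sqge sqgt : L.Term V → L.Term V → Prop}

open FirstOrder.Language

theorem PartialStatus.forall_mem_args {n : ℕ} {f : L.Functions n} {ts : Fin n → L.Term V}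
    {p : L.Term V → Prop} : (∀ t ∈ π.args f ts, p t) ↔ ∀ i ∈ π.pos f, p (ts i) := by
  simp [PartialStatus.args]

theorem SPOGt.spoGe {s t : L.Term V} (h : SPOGt π sqge sqgt s t) : SPOGe π sqge sqgt s t := by
  cases h with
  | arg f ss t i hi h => exact .arg f ss t i hi h
  | strict f ss g ts h h' => exact .strict f ss g ts h h'
  | lex f ss g ts h h' h'' => exact .lex f ss g ts h h' h''.lexGe

theorem SPOGe.refl (hrefl : ∀ t, sqge t t) (t : L.Term V) : SPOGe π sqge sqgt t t := by
  induction t with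
  | var x => exact .var x
  | func f ts ih =>
    exact .lex f ts f ts (fun j hj => .arg f ts _ j hj (ih j)) (hrefl _)
      (LexGe.map_map _ _ _ fun i _ => ih i)

/-- The four laws need a simultaneous induction, since composing weak list comparisons uses the
mixed laws on arguments. Each appeal shrinks the first term, or keeps it and shrinks the second, or
keeps both and shrinks the third. -/
theorem SPO.transAt (hsq : IsOrderPair sqge sqgt) (s t u : L.Term V) :
    TransAt (SPOGe π sqge sqgt) (SPOGt π sqge sqgt) s t u := by
  induction s generalizing t u with
  | var x =>
    constructor <;> intro h₁ h₂ <;> cases h₁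
    all_goals exact h₂
  | func f ss ihs =>
    induction t generalizing u with
    | var y =>
      constructor <;> intro h₁ h₂ <;> cases h₂ <;> exact h₁
    | func g ts iht =>
      have hgg : ∀ a b c, sqgt a b → sqge b c → sqgt a c :=
        fun a b c h h' => hsq.compat a a b c (hsq.ge_refl a) h h'
      have hge : ∀ a b c, sqge a b → sqgt b c → sqgt a c :=
        fun a b c h h' => hsq.compat a b c c h h' (hsq.ge_refl c)
      induction u with
      | var z =>
        have key : SPOGe π sqge sqgt (.func f ss) (.func g ts) →
            SPOGe π sqge sqgt (.func g ts) (.var z) →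
            SPOGt π sqge sqgt (.func f ss) (.var z) := by
          intro h₁ h₂
          cases h₂ with
          | arg _ _ _ j hj h₂ =>
            cases h₁ with
            | arg _ _ _ i hi h₁ =>
              exact .arg _ _ _ i hi ((ihs i _ _).ge_ge h₁ (.arg _ _ _ j hj h₂))
            | strict _ _ _ _ h₁ _ => exact (iht j _).gt_ge (h₁ j hj) h₂
            | lex _ _ _ _ h₁ _ _ => exact (iht j _).gt_ge (h₁ j hj) h₂
        exact ⟨fun h₁ h₂ => (key h₁ h₂).spoGe, fun h₁ h₂ => key h₁ h₂.spoGe,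
          fun h₁ h₂ => key h₁.spoGe h₂, fun h₁ h₂ => key h₁.spoGe h₂.spoGe⟩
      | func k us ihu =>
        have hlex : TransAt (LexGe (SPOGe π sqge sqgt) (SPOGt π sqge sqgt))
            (LexGt (SPOGe π sqge sqgt) (SPOGt π sqge sqgt))
            (π.args f ss) (π.args g ts) (π.args k us) := by
          refine TransAt.lex ?_
          rw [PartialStatus.forall_mem_args]
          exact fun i _ t _ u _ => ihs i t u
        have hdom : SPOGe π sqge sqgt (.func f ss) (.func g ts) →
            (∀ j ∈ π.pos k, SPOGt π sqge sqgt (.func g ts) (us j)) →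
            ∀ j ∈ π.pos k, SPOGt π sqge sqgt (.func f ss) (us j) :=
          fun h₁ h j hj => (ihu j).ge_gt h₁ (h j hj)
        have harg : ∀ i ∈ π.pos f, SPOGe π sqge sqgt (ss i) (.func g ts) →
            SPOGe π sqge sqgt (.func g ts) (.func k us) →
            SPOGt π sqge sqgt (.func f ss) (.func k us) :=
          fun i hi h h' => .arg _ _ _ i hi ((ihs i _ _).ge_ge h h')
        have harg' : ∀ j ∈ π.pos g, SPOGe π sqge sqgt (ts j) (.func k us) →
            (∀ j ∈ π.pos g, SPOGt π sqge sqgt (.func f ss) (ts j)) →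
            SPOGt π sqge sqgt (.func f ss) (.func k us) :=
          fun j hj h h' => (iht j _).gt_ge (h' j hj) h
        have hge_gt : SPOGe π sqge sqgt (.func f ss) (.func g ts) →
            SPOGt π sqge sqgt (.func g ts) (.func k us) →
            SPOGt π sqge sqgt (.func f ss) (.func k us) := by
          intro h₁ h₂
          have hd := hdom h₁
          cases h₁ with
          | arg _ _ _ i hi h₁ => exact harg i hi h₁ h₂.spoGe
          | strict _ _ _ _ d₁ h₁ =>
            cases h₂ with
            | arg _ _ _ j hj h₂ => exact harg' j hj h₂ d₁
            | strict _ _ _ _ d₂ h₂ => exact .strict _ _ _ _ (hd d₂) (hsq.gt_trans _ _ _ h₁ h₂)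
            | lex _ _ _ _ d₂ h₂ l₂ => exact .strict _ _ _ _ (hd d₂) (hgg _ _ _ h₁ h₂)
          | lex _ _ _ _ d₁ h₁ l₁ =>
            cases h₂ with
            | arg _ _ _ j hj h₂ => exact harg' j hj h₂ d₁
            | strict _ _ _ _ d₂ h₂ => exact .strict _ _ _ _ (hd d₂) (hge _ _ _ h₁ h₂)
            | lex _ _ _ _ d₂ h₂ l₂ =>
              exact .lex _ _ _ _ (hd d₂) (hsq.ge_trans _ _ _ h₁ h₂) (hlex.ge_gt l₁ l₂)
        -- Weak steps by `arg` or `strict` are already strict, so they reduce to `hge_gt`; only a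
        -- weak `lex` step is new.
        have hgt_ge : SPOGt π sqge sqgt (.func f ss) (.func g ts) →
            SPOGe π sqge sqgt (.func g ts) (.func k us) →
            SPOGt π sqge sqgt (.func f ss) (.func k us) := by
          intro h₁ h₂
          have hd := hdom h₁.spoGe
          cases h₂ with
          | arg _ _ _ j hj h₂ => exact hge_gt h₁.spoGe (.arg _ _ _ j hj h₂)
          | strict _ _ _ _ d₂ h₂ => exact hge_gt h₁.spoGe (.strict _ _ _ _ d₂ h₂)
          | lex _ _ _ _ d₂ h₂ l₂ =>
            cases h₁ with
            | arg _ _ _ i hi h₁ => exact harg i hi h₁ (.lex _ _ _ _ d₂ h₂ l₂)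
            | strict _ _ _ _ d₁ h₁ => exact .strict _ _ _ _ (hd d₂) (hgg _ _ _ h₁ h₂)
            | lex _ _ _ _ d₁ h₁ l₁ =>
              exact .lex _ _ _ _ (hd d₂) (hsq.ge_trans _ _ _ h₁ h₂) (hlex.gt_ge l₁ l₂)
        refine ⟨?_, hge_gt, hgt_ge, fun h₁ h₂ => hge_gt h₁.spoGe h₂⟩
        intro h₁ h₂
        have hd := hdom h₁
        cases h₁ with
        | arg _ _ _ i hi h₁ => exact (harg i hi h₁ h₂).spoGe
        | strict _ _ _ _ d₁ h₁ => exact (hgt_ge (.strict _ _ _ _ d₁ h₁) h₂).spoGe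
        | lex _ _ _ _ d₁ h₁ l₁ =>
          cases h₂ with
          | arg _ _ _ j hj h₂ => exact (harg' j hj h₂ d₁).spoGe
          | strict _ _ _ _ d₂ h₂ => exact .strict _ _ _ _ (hd d₂) (hge _ _ _ h₁ h₂)
          | lex _ _ _ _ d₂ h₂ l₂ =>
            exact .lex _ _ _ _ (hd d₂) (hsq.ge_trans _ _ _ h₁ h₂) (hlex.ge_ge l₁ l₂)

-- Closure under substitutions and contexts

theorem SPO.subst (hrefl : ∀ t, sqge t t) (hge : IsStable sqge) (hgt : IsStable sqgt)
    (σ : V → L.Term V) (s t : L.Term V) :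
    (SPOGe π sqge sqgt s t → SPOGe π sqge sqgt (s.subst σ) (t.subst σ)) ∧
      (SPOGt π sqge sqgt s t → SPOGt π sqge sqgt (s.subst σ) (t.subst σ)) := by
  have hargs : ∀ {n : ℕ} (f : L.Functions n) (ts : Fin n → L.Term V),
      π.args f (fun i => (ts i).subst σ) = (π.args f ts).map (Term.subst · σ) :=
    fun f ts => by simp [PartialStatus.args]
  induction s generalizing t with
  | var x =>
    refine ⟨fun h => ?_, fun h => ?_⟩ <;> cases h
    -- The variable may be replaced by any term, so full reflexivity is needed.
    exact SPOGe.refl hrefl _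
  | func f ss ihs =>
    induction t with
    | var y =>
      refine ⟨fun h => ?_, fun h => ?_⟩
      · cases h with
        | arg _ _ _ i hi h => exact .arg _ _ _ i hi ((ihs i _).1 h)
      · cases h with
        | arg _ _ _ i hi h => exact .arg _ _ _ i hi ((ihs i _).1 h)
    | func g ts iht =>
      have hmem : ∀ s ∈ π.args f ss, ∀ t,
          (SPOGe π sqge sqgt s t → SPOGe π sqge sqgt (s.subst σ) (t.subst σ)) ∧
            (SPOGt π sqge sqgt s t → SPOGt π sqge sqgt (s.subst σ) (t.subst σ)) := by
        rw [PartialStatus.forall_mem_args]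
        exact fun i _ => ihs i
      refine ⟨fun h => ?_, fun h => ?_⟩
      · cases h with
        | arg _ _ _ i hi h => exact .arg _ _ _ i hi ((ihs i _).1 h)
        | strict _ _ _ _ d h =>
          exact .strict _ _ _ _ (fun j hj => (iht j).2 (d j hj)) (hgt _ _ σ h)
        | lex _ _ _ _ d h l =>
          refine .lex _ _ _ _ (fun j hj => (iht j).2 (d j hj)) (hge _ _ σ h) ?_
          rw [hargs, hargs]
          exact l.map_of_forall_mem _ (fun a ha b _ => (hmem a ha b).1)
            (fun a ha b _ => (hmem a ha b).2)
      · cases h with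
        | arg _ _ _ i hi h => exact .arg _ _ _ i hi ((ihs i _).1 h)
        | strict _ _ _ _ d h =>
          exact .strict _ _ _ _ (fun j hj => (iht j).2 (d j hj)) (hgt _ _ σ h)
        | lex _ _ _ _ d h l =>
          refine .lex _ _ _ _ (fun j hj => (iht j).2 (d j hj)) (hge _ _ σ h) ?_
          rw [hargs, hargs]
          exact l.map_of_forall_mem _ (fun a ha b _ => (hmem a ha b).1)
            (fun a ha b _ => (hmem a ha b).2)

theorem SPOGe.update {n : ℕ} (f : L.Functions n) (ts : Fin n → L.Term V) (i : Fin n)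
    {s t : L.Term V} (hrefl : ∀ t, sqge t t) (h : SPOGe π sqge sqgt s t)
    (hsq : sqge (.func f (Function.update ts i s)) (.func f (Function.update ts i t))) :
    SPOGe π sqge sqgt (.func f (Function.update ts i s)) (.func f (Function.update ts i t)) := by
  have hall : ∀ j, SPOGe π sqge sqgt (Function.update ts i s j) (Function.update ts i t j) := by
    intro j
    by_cases hj : j = i
    · subst hj
      simpa using h
    · simpa [hj] using SPOGe.refl hrefl (ts j)
  exact .lex _ _ _ _ (fun j hj => .arg _ _ _ j hj (hall j)) hsq
    (LexGe.map_map _ _ _ fun j _ => hall j)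

-- Well-foundedness

theorem PartialStatus.exists_length_pos_le (hfin : Finite (Σ n, L.Functions n))
    (π : PartialStatus L) : ∃ N, ∀ (n : ℕ) (f : L.Functions n), (π.pos f).length ≤ N := by
  obtain ⟨N, hN⟩ := (Set.finite_range
    fun p : Σ n, L.Functions n => (π.pos p.2).length).bddAbove
  exact ⟨N, fun n f => hN ⟨⟨n, f⟩, rfl⟩⟩

theorem SPOGt.isWellFoundedGt (hfin : Finite (Σ n, L.Functions n))
    (hsq : IsOrderPair sqge sqgt) (hwf : IsWellFoundedGt sqgt) :
    IsWellFoundedGt (SPOGt π sqge sqgt) := by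
  -- Without a length bound `LexGt` can descend forever: if `a > b`, then `[a] > [b, a] > [b, b, a]
  -- > ⋯`.
  obtain ⟨N, hN⟩ := π.exists_length_pos_le hfin
  let A : L.Term V → Prop := Acc fun a b => SPOGt π sqge sqgt b a
  have hA : IsWellFoundedGt fun a b : {t // A t} => SPOGt π sqge sqgt a.1 b.1 :=
    ⟨fun a => InvImage.accessible (fun a : {t // A t} => a.1) a.2⟩
  have hlist := IsWellFoundedGt.lexGt (ge := fun a b : {t // A t} => SPOGe π sqge sqgt a.1 b.1)
    (fun a => SPOGe.refl hsq.ge_refl a.1)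
    (fun a b c => (SPO.transAt hsq a.1 b.1 c.1).ge_ge)
    (fun a b c => (SPO.transAt hsq a.1 b.1 c.1).ge_gt) hA N
  have hprod := IsWellFoundedGt.lex_prod hsq.ge_refl hsq.ge_trans
    (fun a b c h h' => hsq.compat a b c c h h' (hsq.ge_refl c)) hwf hlist
  have key : ∀ (p : L.Term V × {l : List {t // A t} // l.length ≤ N}) (n : ℕ)
      (f : L.Functions n) (ss : Fin n → L.Term V), p.1 = .func f ss →
      p.2.1.map Subtype.val = π.args f ss → A (.func f ss) := by
    intro p
    induction p using hprod.induction with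
    | _ p ih =>
      obtain ⟨p₁, p₂, hp₂⟩ := p
      rintro n f ss rfl hp
      have hss : ∀ i ∈ π.pos f, A (ss i) := by
        rw [← PartialStatus.forall_mem_args (p := A), ← hp]
        simp +contextual
      refine ⟨_, fun t ht => ?_⟩
      have harg : ∀ i ∈ π.pos f, ∀ t, SPOGe π sqge sqgt (ss i) t → A t := fun i hi t h =>
        ⟨_, fun u hu => (hss i hi).inv ((SPO.transAt hsq _ _ _).ge_gt h hu)⟩
      -- The selected arguments of a smaller term are also below `f(ss)`, hence accessible by this
      -- inner induction. They thus form a list to which the outer induction applies.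
      induction t with
      | var y =>
        cases ht with
        | arg _ _ _ i hi h => exact harg i hi _ h
      | func g ts iht =>
        have hlift : (∀ j ∈ π.pos g, A (ts j)) → ∃ l : {l : List {t // A t} // l.length ≤ N},
            l.1.map Subtype.val = π.args g ts := fun h =>
          ⟨⟨(π.args g ts).attachWith A (PartialStatus.forall_mem_args.2 h), by
            simpa [PartialStatus.args] using hN _ g⟩, by simp⟩
        cases ht with
        | arg _ _ _ i hi h => exact harg i hi _ h
        | strict _ _ _ _ d h =>
          obtain ⟨l, hl⟩ := hlift fun j hj => iht j (d j hj)
          exact ih (.func g ts, l) (.inl h) _ g ts rfl hl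
        | lex _ _ _ _ d h hlex =>
          obtain ⟨l, hl⟩ := hlift fun j hj => iht j (d j hj)
          rw [← hp, ← hl] at hlex
          exact ih (.func g ts, l) (.inr ⟨h, hlex.of_map⟩) _ g ts rfl hl
  refine ⟨fun t => ?_⟩
  induction t with
  | var x => exact ⟨_, fun u hu => by cases hu⟩
  | func f ts ih =>
    exact key (.func f ts, ⟨(π.args f ts).attachWith A
      (PartialStatus.forall_mem_args.2 fun i _ => ih i), by
        simpa [PartialStatus.args] using hN _ f⟩) _ f ts rfl (by simp)

end TermOrder

open TermOrder in
theorem mainTheorem5 {L : FirstOrder.Language} {V : Type*}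
    (hfin : Finite (Σ n, L.Functions n))
    (π : TermOrder.PartialStatus L) (ge sqge sqgt : L.Term V → L.Term V → Prop)
    (htriple : TermOrder.IsReductionTriple ge sqge sqgt) :
    TermOrder.IsReductionPair
      (TermOrder.MSPOGe π ge sqge sqgt) (TermOrder.SPOGt π sqge sqgt) := by
  obtain ⟨hge, hsq, hsqge, hsqgt, hwf, hharm⟩ := htriple
  have htr := SPO.transAt (π := π) hsq
  have hsub := SPO.subst (π := π) hsq.ge_refl hsqge hsqgt
  have hwf' : IsWellFoundedGt (SPOGt π sqge sqgt) := SPOGt.isWellFoundedGt hfin hsq hwf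
  have hrefl : ∀ t, MSPOGe π ge sqge sqgt t t :=
    fun t => ⟨hge.refl t, SPOGe.refl hsq.ge_refl t⟩
  have htrans : ∀ s t u, MSPOGe π ge sqge sqgt s t → MSPOGe π ge sqge sqgt t u →
      MSPOGe π ge sqge sqgt s u :=
    fun s t u h h' => ⟨hge.trans _ _ _ h.1 h'.1, (htr s t u).ge_ge h.2 h'.2⟩
  refine ⟨⟨hrefl, htrans, fun t => hwf'.irrefl.irrefl t, fun s t u => (htr s t u).gt_gt,
    fun a b c d h₁ h₂ h₃ => (htr a c d).gt_ge ((htr a b c).ge_gt h₁.2 h₂) h₃.2⟩,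
    ⟨hrefl, htrans, fun s t σ h => ⟨hge.stable _ _ σ h.1, (hsub σ s t).1 h.2⟩, ?_⟩,
    hwf', fun s t σ => (hsub σ s t).2⟩
  intro n f ts i s t h
  refine ⟨hge.contexts n f ts i s t h.1, h.2.update f ts i hsq.ge_refl ?_⟩
  -- Harmony is applied to the tuple already holding `s`; the second update overwrites the first.
  have := hharm n f (Function.update ts i s) i t (by simpa using h.1)
  simpa using this
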